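/- Let $H^2(\mathbb D^2)$ be the Hardy space of the bidisk, identified through boundary values with the subspace of $L^2(\mathbb T^2)$ of functions all of whose Fourier frequencies are nonnegative, and let $H^2_2\subset H^2(\mathbb D^2)$ be the subspace of functions of $z_2$ alone. Let $\phi$ be an inner function on $\mathbb D^2$ (bounded, holomorphic, with unimodular nontangential limits a.e. on $\mathbb T^2$), let $K_\phi=H^2(\mathbb D^2)\ominus\phi H^2(\mathbb D^2)$, and let $P_\phi$ and $P_{H^2_2}$ be the orthogonal projections onto $K_\phi$ and $H^2_2$. Let $\alpha\in\mathbb T$ and let $\sigma_\alpha$ be the Clark measure of $\phi$, i.e. the finite positive Borel measure on $\mathbb T^2$ with $$\frac{1-|\phi(z)|^2}{|\alpha-\phi(z)|^2}=\int_{\mathbb T^2}P_{z_1}(\zeta_1)P_{z_2}(\zeta_2)\,d\sigma_\alpha(\zeta),\qquad z\in\mathbb D^2,$$ where $P_{z_j}$ is the Poisson kernel of the disk. Put $k_w(z)=\frac1{(1-z_1\bar w_1)(1-z_2\bar w_2)}$ and $k^\phi_w(z)=(1-\phi(z)\overline{\phi(w)})k_w(z)$, and let $J_\alpha:K_\phi\to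 L^2(\sigma_\alpha)$ be the Clark embedding, i.e. the bounded linear map with $J_\alpha k^\phi_w=(1-\alpha\overline{\phi(w)})k_w$ for all $w\in\mathbb D^2$. Put $$\psi^1_\alpha(z)=\bar\alpha\,\frac{(B_1\phi)(z)}{1-\bar\alpha\phi(0,z_2)},\qquad (B_1\phi)(z)=\frac{\phi(z)-\phi(0,z_2)}{z_1},$$ let $S^1_\phi f=P_\phi(z_1f)$ be the compressed shift on $K_\phi$, and let $$U^1_\alpha=S^1_\phi+P_\phi P_{H^2_2}M_{\overline{\psi^1_\alpha}}\qquad\text{on }K_\phi .$$ Assume that $J_\alpha$ is surjective, that $\psi^1_\alpha$ is bounded on $\mathbb D^2$, that $\frac{1}{1-\bar\alpha\phi(0,z_2)}\in H^2_2$, that $\phi(0,z_2)\not\equiv0$, and that $\phi$ depends on both $z_1$ and $z_2$. Then the projection $P_\phi$ is needed in the formula for $U^1_\alpha$: there is $f\in K_\phi$ with $P_{H^2_2}M_{\overline{\psi^1_\alpha}}f\notin K_\phi$, and it is not true that $U^1_\alpha f=S^1_\phi f+P_{H^2_2}M_{\overline{\psi^1_\alpha}}f$ for all $f\in K_\phi$.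 -/

import Mathlib

open MeasureTheory Filter Topology
open scoped ENNReal ComplexConjugate

noncomputable section

namespace BidiskClark

/-! ### The bidisk and the two-torus -/

/-- The open unit bidisk `𝔻²`. -/
def bidisk : Set (ℂ × ℂ) := {z | ‖z.1‖ < 1 ∧ ‖z.2‖ < 1}

/-- The two-torus `𝕋²`, parametrized by angles in `(ℝ/ℤ)²`. -/
abbrev Torus : Type := UnitAddTorus (Fin 2)

/-- The point `ζ = (ζ₁, ζ₂) ∈ 𝕋² ⊆ ℂ²` with angles `x`. -/
def torusPt (x : Torus) : ℂ × ℂ :=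
  ((AddCircle.toCircle (x 0) : ℂ), (AddCircle.toCircle (x 1) : ℂ))

/-- Normalized Lebesgue (Haar) measure on `𝕋²`. -/
def torusMeasure : Measure Torus :=
  Measure.pi fun _ : Fin 2 => (AddCircle.haarAddCircle : Measure UnitAddCircle)

instance : IsProbabilityMeasure torusMeasure := by
  unfold torusMeasure; infer_instance

/-- `L²(𝕋²)`. -/
abbrev L2T : Type := Lp ℂ 2 torusMeasure

/-- `L^∞(𝕋²)`. -/
abbrev LInfT : Type := Lp ℂ ∞ torusMeasure

/-- The Fourier coefficient `∫ ζ^{-n} f dm` of a function on `𝕋²`. -/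
def fourierCoef (f : Torus → ℂ) (n : Fin 2 → ℤ) : ℂ :=
  ∫ x, UnitAddTorus.mFourier (-n) x * f x ∂torusMeasure

lemma fourierCoef_eq_inner (n : Fin 2 → ℤ) (f : L2T) :
    fourierCoef f n =
      inner ℂ (ContinuousMap.toLp (E := ℂ) 2 torusMeasure ℂ (UnitAddTorus.mFourier n)) f := by
  rw [L2.inner_def, fourierCoef]
  refine integral_congr_ae ?_
  filter_upwards [ContinuousMap.coeFn_toLp (p := 2) (𝕜 := ℂ) torusMeasure
    (UnitAddTorus.mFourier (d := Fin 2) n)] with x hx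
  rw [hx, RCLike.inner_apply, UnitAddTorus.mFourier_neg, mul_comm]

/-- The subspace of `L²(𝕋²)` of functions whose Fourier coefficients vanish off `S`. -/
def freqSubspace (S : Set (Fin 2 → ℤ)) : Submodule ℂ L2T where
  carrier := {f | ∀ n, n ∉ S → fourierCoef f n = 0}
  zero_mem' := fun n _ => by rw [fourierCoef_eq_inner, inner_zero_right]
  add_mem' := fun {f g} hf hg n hn => by
    have h1 := hf n hn
    have h2 := hg n hn
    rw [fourierCoef_eq_inner] at h1 h2 ⊢
    rw [inner_add_right, h1, h2, add_zero]
  smul_mem' := fun c f hf n hn => by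
    have h1 := hf n hn
    rw [fourierCoef_eq_inner] at h1 ⊢
    rw [inner_smul_right, h1, mul_zero]

lemma isClosed_freqSubspace (S : Set (Fin 2 → ℤ)) :
    IsClosed (freqSubspace S : Set L2T) := by
  have h : (freqSubspace S : Set L2T) = ⋂ n, ⋂ (_ : n ∉ S), {f | inner ℂ
      (ContinuousMap.toLp (E := ℂ) 2 torusMeasure ℂ (UnitAddTorus.mFourier n)) f = (0 : ℂ)} := by
    ext f
    simp only [Set.mem_iInter, Set.mem_ofPred_eq, ← fourierCoef_eq_inner]
    rfl
  rw [h]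
  refine isClosed_iInter fun n => isClosed_iInter fun _ => ?_
  exact isClosed_eq (by fun_prop) continuous_const

instance (S : Set (Fin 2 → ℤ)) : CompleteSpace (freqSubspace S) :=
  (isClosed_freqSubspace S).completeSpace_coe

/-- The Hardy space `H²(𝔻²)`, identified with the subspace of `L²(𝕋²)` of functions all of whose
frequencies are nonnegative. -/
def H2 : Submodule ℂ L2T := freqSubspace {n | 0 ≤ n 0 ∧ 0 ≤ n 1}

/-- The subspace `H²₂` of `H²(𝔻²)` of functions of `z₂` alone. -/
def H22 : Submodule ℂ L2T := freqSubspace {n | n 0 = 0 ∧ 0 ≤ n 1}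

instance : CompleteSpace H2 := by unfold H2; infer_instance

instance : CompleteSpace H22 := by unfold H22; infer_instance

/-- `F` is the boundary function on `𝕋²` of the holomorphic function `f` on `𝔻²`: the frequencies
of `F` are nonnegative and `f(z) = ∑_{k,l ≥ 0} F̂(k,l) z₁ᵏ z₂ˡ` on `𝔻²`. -/
def IsBoundaryFunction (f : ℂ × ℂ → ℂ) (F : Torus → ℂ) : Prop :=
  (∀ n : Fin 2 → ℤ, ¬ (0 ≤ n 0 ∧ 0 ≤ n 1) → fourierCoef F n = 0) ∧
    ∀ z ∈ bidisk, HasSum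
      (fun k : ℕ × ℕ => fourierCoef F ![(k.1 : ℤ), (k.2 : ℤ)] * z.1 ^ k.1 * z.2 ^ k.2) (f z)

open Classical in
/-- The boundary function in `L^∞(𝕋²)` of a bounded holomorphic function `f` on `𝔻²`
(which exists and is unique). -/
def boundaryInf (f : ℂ × ℂ → ℂ) : LInfT :=
  if h : ∃ F : LInfT, IsBoundaryFunction f F then h.choose else 0

/-- The multiplication operator `M_b` on `L²(𝕋²)`, for `b ∈ L^∞(𝕋²)`. -/
def mulOp (b : LInfT) : L2T →L[ℂ] L2T :=
  (ContinuousLinearMap.mul ℂ ℂ).holderL torusMeasure ∞ 2 2 b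

/-- The function `ζ ↦ ζ₁` in `L^∞(𝕋²)`. -/
def coord1 : LInfT :=
  ContinuousMap.toLp (E := ℂ) ∞ torusMeasure ℂ (UnitAddTorus.mFourier ![1, 0])

/-! ### Inner functions, model spaces and Clark measures -/

/-- The nontangential approach region at `ζ ∈ 𝕋²` with aperture `A`. -/
def stolz (A : ℝ) (ζ : ℂ × ℂ) : Set (ℂ × ℂ) :=
  {z | z ∈ bidisk ∧ ‖z.1 - ζ.1‖ ≤ A * (1 - ‖z.1‖) ∧ ‖z.2 - ζ.2‖ ≤ A * (1 - ‖z.2‖)}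

/-- `f` has the nontangential limit `c` at `ζ ∈ 𝕋²`. -/
def HasNontangentialLimit (f : ℂ × ℂ → ℂ) (ζ : ℂ × ℂ) (c : ℂ) : Prop :=
  ∀ A : ℝ, 1 < A → Tendsto f (𝓝[stolz A ζ] ζ) (𝓝 c)

/-- `f` is bounded on `𝔻²`. -/
def BoundedOnBidisk (f : ℂ × ℂ → ℂ) : Prop := ∃ C : ℝ, ∀ z ∈ bidisk, ‖f z‖ ≤ C

/-- Inner functions on `𝔻²`: bounded holomorphic functions whose nontangential limits are
unimodular at almost every point of `𝕋²`. -/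
structure IsInner (φ : ℂ × ℂ → ℂ) : Prop where
  holomorphic : DifferentiableOn ℂ φ bidisk
  bounded : BoundedOnBidisk φ
  unimodular : ∀ᵐ x ∂torusMeasure, ∃ c : ℂ, ‖c‖ = 1 ∧ HasNontangentialLimit φ (torusPt x) c

/-- The model space `K_φ = H²(𝔻²) ⊖ φ H²(𝔻²)`. -/
def modelSpace (φ : ℂ × ℂ → ℂ) : Submodule ℂ L2T :=
  H2 ⊓ (H2.map (mulOp (boundaryInf φ) : L2T →ₗ[ℂ] L2T))ᗮ

instance (φ : ℂ × ℂ → ℂ) : CompleteSpace (modelSpace φ) := by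
  have h : IsClosed (H2 : Set L2T) := isClosed_freqSubspace _
  have h' : IsClosed (modelSpace φ : Set L2T) := h.inter (Submodule.isClosed_orthogonal _)
  exact h'.completeSpace_coe

/-- The Szegő kernel `k_w(z) = 1 / ((1 - z₁ w̄₁)(1 - z₂ w̄₂))`. -/
def szego (w z : ℂ × ℂ) : ℂ := 1 / ((1 - z.1 * conj w.1) * (1 - z.2 * conj w.2))

/-- The reproducing kernel `k^φ_w(z) = (1 - φ(z) \overline{φ(w)}) k_w(z)` of `K_φ`. -/
def modelKernel (φ : ℂ × ℂ → ℂ) (w z : ℂ × ℂ) : ℂ := (1 - φ z * conj (φ w)) * szego w z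

/-- `σ` is the Clark measure `σ_α` of `φ`: the finite positive Borel measure on `𝕋²` whose Poisson
integral is `(1 - |φ|²) / |α - φ|²`. -/
structure IsClarkMeasure (φ : ℂ × ℂ → ℂ) (α : ℂ) (σ : Measure Torus) : Prop where
  finite : IsFiniteMeasure σ
  poisson : ∀ z ∈ bidisk, (1 - ‖φ z‖ ^ 2) / ‖α - φ z‖ ^ 2 =
    ∫ x, poissonKernel 0 z.1 (torusPt x).1 * poissonKernel 0 z.2 (torusPt x).2 ∂σ

/-- `J` is the Clark embedding `J_α : K_φ → L²(σ)`: the bounded linear map with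
`J k^φ_w = (1 - α \overline{φ(w)}) k_w` for all `w ∈ 𝔻²` (unique, since the kernels `k^φ_w` span a
dense subspace of `K_φ`). -/
def IsClarkEmbedding (φ : ℂ × ℂ → ℂ) (α : ℂ) (σ : Measure Torus)
    (J : modelSpace φ →L[ℂ] Lp ℂ 2 σ) : Prop :=
  ∀ w ∈ bidisk, ∀ g : modelSpace φ, IsBoundaryFunction (modelKernel φ w) (g : L2T) →
    (J g : Torus → ℂ) =ᵐ[σ] fun x => (1 - α * conj (φ w)) * szego w (torusPt x)

/-! ### The operators -/

/-- The backward shift in `z₁`: `(B₁ f)(z) = (f(z) - f(0, z₂)) / z₁`, which is holomorphically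
extended to `z₁ = 0` by the value `∂f/∂z₁ (0, z₂)`. -/
def backwardShift1 (f : ℂ × ℂ → ℂ) (z : ℂ × ℂ) : ℂ := dslope (fun u => f (u, z.2)) 0 z.1

/-- `ψ¹_α(z) = ᾱ (B₁ φ)(z) / (1 - ᾱ φ(0, z₂))`. -/
def psi1 (φ : ℂ × ℂ → ℂ) (α : ℂ) (z : ℂ × ℂ) : ℂ :=
  conj α * (backwardShift1 φ z / (1 - conj α * φ (0, z.2)))

/-- The orthogonal projection `P_φ` onto `K_φ`. -/
def projModel (φ : ℂ × ℂ → ℂ) : L2T →L[ℂ] modelSpace φ := (modelSpace φ).orthogonalProjectionOnto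

/-- The compressed shift `S¹_φ f = P_φ (z₁ f)` on `K_φ`. -/
def compressedShift1 (φ : ℂ × ℂ → ℂ) : modelSpace φ →L[ℂ] modelSpace φ :=
  projModel φ ∘L mulOp coord1 ∘L (modelSpace φ).subtypeL

/-- The operator `P_{H²₂} M_{\overline{ψ¹_α}} : K_φ → H²₂ ⊆ L²(𝕋²)`, with `P_{H²₂}` the orthogonal
projection of `L²(𝕋²)` onto `H²₂`. -/
def perturbation1 (φ : ℂ × ℂ → ℂ) (α : ℂ) : modelSpace φ →L[ℂ] L2T :=
  H22.starProjection ∘L mulOp (star (boundaryInf (psi1 φ α))) ∘L (modelSpace φ).subtypeL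

/-- `U¹_α = S¹_φ + P_φ P_{H²₂} M_{\overline{ψ¹_α}}` on `K_φ`. -/
def clarkUnitary1 (φ : ℂ × ℂ → ℂ) (α : ℂ) : modelSpace φ →L[ℂ] modelSpace φ :=
  compressedShift1 φ + projModel φ ∘L perturbation1 φ α

end BidiskClark

end

/-!
Write `φ₀(z) = φ(0, z₂)`, `ψ = ψ¹_α` and `P` for the projection onto `H²₂`. If `P M_{ψ̄}` mapped
`K_φ` into itself, then for every `f ∈ K_φ` one would have
`0 = ⟨P M_{ψ̄} f, φ⟩ = ⟨f, ψ P φ⟩ = ⟨f, ψ φ₀⟩`, so that `ψ φ₀ ∈ H²` would be orthogonal to `K_φ`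
and therefore equal to `φ h` for some `h ∈ H²` (`inner_perturbation1`,
`mem_innerRange_of_orthogonal`).

Since `z₁ ψ (1 - ᾱ φ₀) = ᾱ (φ - φ₀)`, this gives `φ u = φ₀²` with
`u = φ₀ - z₁ g`, `g = α (1 - ᾱ φ₀) h ∈ H²`. On the torus `|φ| = 1` and `|φ₀| ≤ 1`, hence
`‖u‖ = ‖φ₀²‖ ≤ ‖φ₀‖`, while `‖u‖² = ‖φ₀‖² + ‖z₁ g‖²` because `φ₀ ∈ H²₂` and `z₁ g ⊥ H²₂`.
So `z₁ g = 0` and `φ φ₀ = φ₀²` (`boundaryInf_mul_sliceZero_of_mem_innerRange`). As `φ₀` is not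
identically zero, `φ = φ₀` on the bidisk (`eq_sliceZero_of_mul`), which contradicts the dependence
of `φ` on `z₁`.

To pass between functions on the bidisk and elements of `L²(𝕋²)`, it is shown that a bounded
function that is holomorphic in each variable has a double power series (`hasSum_taylorCoef2`), that
its coefficients are the Fourier coefficients of an essentially bounded function on the torus
(`exists_isBoundaryFunction`), and that this function is the almost everywhere limit of the
dilations `ζ ↦ f(rζ)` along a sequence of radii, simultaneously for finitely many `f`
(`exists_seq_tendsto_boundaryInf`). The last fact carries algebraic identities over to the torus,
and through the nontangential limits it gives `|φ| = 1` there.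
-/

noncomputable section

namespace BidiskClark

/-! ### Power series of bounded holomorphic functions on the bidisk -/

/-- `f` is holomorphic on the bidisk in each variable separately. -/
structure SeparatelyHolomorphic (f : ℂ × ℂ → ℂ) : Prop where
  left : ∀ w ∈ Metric.ball (0 : ℂ) 1, DifferentiableOn ℂ (fun z => f (z, w)) (Metric.ball 0 1)
  right : ∀ z ∈ Metric.ball (0 : ℂ) 1, DifferentiableOn ℂ (fun w => f (z, w)) (Metric.ball 0 1)

lemma mk_mem_bidisk {z w : ℂ} (hz : z ∈ Metric.ball (0 : ℂ) 1) (hw : w ∈ Metric.ball (0 : ℂ) 1) :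
    (z, w) ∈ bidisk :=
  ⟨mem_ball_zero_iff.1 hz, mem_ball_zero_iff.1 hw⟩

lemma _root_.DifferentiableOn.separatelyHolomorphic {f : ℂ × ℂ → ℂ}
    (hf : DifferentiableOn ℂ f bidisk) : SeparatelyHolomorphic f where
  left w hw := hf.comp (by fun_prop) fun _ hz => mk_mem_bidisk hz hw
  right z hz := hf.comp (by fun_prop) fun _ hw => mk_mem_bidisk hz hw

/-- The `n`-th Taylor coefficient at `0`, as the value at `0` of the `n`-fold backward shift. -/
def taylorCoef (g : ℂ → ℂ) (n : ℕ) : ℂ := (Function.swap dslope 0)^[n] g 0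

lemma taylorCoef_eq {g : ℂ → ℂ} (hg : DifferentiableOn ℂ g (Metric.ball 0 1)) (n : ℕ) :
    taylorCoef g n = iteratedDeriv n g 0 / n.factorial := by
  have hp := (hg.analyticAt (Metric.ball_mem_nhds 0 one_pos)).hasFPowerSeriesAt
  have h := (hp.has_fpower_series_iterate_dslope_fslope n).coeff_zero 1
  rw [taylorCoef, ← h]
  change (FormalMultilinearSeries.fslope^[n] _).coeff 0 = _
  rw [FormalMultilinearSeries.coeff_iterate_fslope, zero_add]
  simp

lemma norm_taylorCoef_le {g : ℂ → ℂ} (hg : DifferentiableOn ℂ g (Metric.ball 0 1)) {C : ℝ}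
    (hC : ∀ z ∈ Metric.ball (0 : ℂ) 1, ‖g z‖ ≤ C) (n : ℕ) : ‖taylorCoef g n‖ ≤ C := by
  have key : ∀ r ∈ Set.Ioo (0 : ℝ) 1, ‖taylorCoef g n‖ ≤ C / r ^ n := by
    intro r hr
    have hd : DiffContOnCl ℂ g (Metric.ball 0 r) :=
      (hg.mono (Metric.closure_ball_subset_closedBall.trans
        (Metric.closedBall_subset_ball hr.2))).diffContOnCl
    have h := Complex.norm_iteratedDeriv_le_of_forall_mem_sphere_norm_le n hr.1 hd (C := C)
      fun z hz => hC z (Metric.sphere_subset_closedBall.trans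
        (Metric.closedBall_subset_ball hr.2) hz)
    rw [taylorCoef_eq hg, norm_div, Complex.norm_natCast, div_le_iff₀ (by positivity)]
    exact h.trans_eq (by ring)
  have hlim : Tendsto (fun r : ℝ => C / r ^ n) (𝓝[<] 1) (𝓝 (C / 1 ^ n)) :=
    ((ContinuousAt.div continuousAt_const (by fun_prop) (by simp)).tendsto).mono_left
      nhdsWithin_le_nhds
  rw [one_pow, div_one] at hlim
  exact ge_of_tendsto hlim (eventually_of_mem (Ioo_mem_nhdsLT one_pos) key)

lemma hasSum_taylorCoef {g : ℂ → ℂ} (hg : DifferentiableOn ℂ g (Metric.ball 0 1)) {z : ℂ}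
    (hz : z ∈ Metric.ball (0 : ℂ) 1) : HasSum (fun n => taylorCoef g n * z ^ n) (g z) := by
  have h := Complex.hasSum_taylorSeries_on_ball (r := 1) (by simpa using hg) (by simpa using hz)
  refine h.congr_fun fun n => ?_
  rw [taylorCoef_eq hg]
  simp only [sub_zero, smul_eq_mul]
  ring

lemma backwardShift1_add_mul (f : ℂ × ℂ → ℂ) (z : ℂ × ℂ) :
    z.1 * backwardShift1 f z = f z - f (0, z.2) := by
  simpa [backwardShift1] using sub_smul_dslope (fun u => f (u, z.2)) 0 z.1

lemma BoundedOnBidisk.backwardShift1 {f : ℂ × ℂ → ℂ} (hb : BoundedOnBidisk f)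
    (hf : SeparatelyHolomorphic f) : BoundedOnBidisk (backwardShift1 f) := by
  obtain ⟨C, hC⟩ := hb
  refine ⟨2 * C + 1, fun z hz => ?_⟩
  have hw : z.2 ∈ Metric.ball (0 : ℂ) 1 := mem_ball_zero_iff.2 hz.2
  have h0 : (0 : ℂ) ∈ Metric.ball (0 : ℂ) 1 := Metric.mem_ball_self one_pos
  have h := Complex.norm_dslope_le_div_of_mapsTo_ball (R₂ := 2 * C + 1) (hf.left z.2 hw)
    (fun u hu => ?_) (mem_ball_zero_iff.2 hz.1)
  · simpa [BidiskClark.backwardShift1] using h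
  · have h1 := hC _ (mk_mem_bidisk hu hw)
    have h2 := hC _ (mk_mem_bidisk h0 hw)
    have h3 := norm_sub_le (f (u, z.2)) (f (0, z.2))
    simp only [Metric.mem_closedBall, dist_eq_norm]
    linarith

/-- For `z₁ = 0` the backward shift is the limit of `w ↦ B₁ f (h, w)` as `h → 0`, which is uniform
because `B₁ f (h, w) - B₁ f (0, w) = h B₁ B₁ f (h, w)` with `B₁ B₁ f` bounded. -/
lemma SeparatelyHolomorphic.backwardShift1 {f : ℂ × ℂ → ℂ} (hf : SeparatelyHolomorphic f)
    (hb : BoundedOnBidisk f) : SeparatelyHolomorphic (backwardShift1 f) := by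
  have hleft : ∀ w ∈ Metric.ball (0 : ℂ) 1,
      DifferentiableOn ℂ (fun z => BidiskClark.backwardShift1 f (z, w)) (Metric.ball 0 1) :=
    fun w hw => (Complex.differentiableOn_dslope (Metric.ball_mem_nhds 0 one_pos)).2 (hf.left w hw)
  have h0 : (0 : ℂ) ∈ Metric.ball (0 : ℂ) 1 := Metric.mem_ball_self one_pos
  have hne : ∀ z ∈ Metric.ball (0 : ℂ) 1, z ≠ 0 →
      DifferentiableOn ℂ (fun w => BidiskClark.backwardShift1 f (z, w)) (Metric.ball 0 1) := by
    intro z hz hz0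
    refine (((hf.right z hz).sub (hf.right 0 h0)).const_mul z⁻¹).congr fun w _ => ?_
    have h := backwardShift1_add_mul f (z, w)
    simp only [Pi.sub_apply] at h ⊢
    rw [← h, inv_mul_cancel_left₀ hz0]
  refine ⟨hleft, fun z hz => ?_⟩
  by_cases hz0 : z = 0
  swap
  · exact hne z hz hz0
  subst hz0
  obtain ⟨C, hC⟩ := hb.backwardShift1 hf
  have hB : ∀ w ∈ Metric.ball (0 : ℂ) 1, ∀ h ∈ Metric.ball (0 : ℂ) 1,
      ‖BidiskClark.backwardShift1 f (h, w) - BidiskClark.backwardShift1 f (0, w)‖ ≤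
        (2 * C + 1) * ‖h‖ := by
    intro w hw h hh
    have := Complex.norm_dslope_le_div_of_mapsTo_ball (R₂ := 2 * C + 1) (hleft w hw)
      (fun u hu => ?_) hh
    · have h4 := sub_smul_dslope (fun z => BidiskClark.backwardShift1 f (z, w)) 0 h
      simp only [sub_zero, smul_eq_mul, div_one] at h4 this
      rw [← h4, norm_mul, mul_comm]
      gcongr
    · have h1 := hC _ (mk_mem_bidisk hu hw)
      have h2 := hC _ (mk_mem_bidisk h0 hw)
      have h3 := norm_sub_le (BidiskClark.backwardShift1 f (u, w))
        (BidiskClark.backwardShift1 f (0, w))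
      simp only [Metric.mem_closedBall, dist_eq_norm]
      linarith
  have hunif : TendstoUniformlyOn (fun h w => BidiskClark.backwardShift1 f (h, w))
      (fun w => BidiskClark.backwardShift1 f (0, w)) (𝓝[≠] 0) (Metric.ball 0 1) := by
    rw [Metric.tendstoUniformlyOn_iff]
    intro ε hε
    have hlim : Tendsto (fun h : ℂ => (2 * C + 1) * ‖h‖) (𝓝[≠] 0) (𝓝 0) := by
      have : ContinuousAt (fun h : ℂ => (2 * C + 1) * ‖h‖) 0 := by fun_prop
      simpa using this.tendsto.mono_left nhdsWithin_le_nhds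
    filter_upwards [hlim.eventually (gt_mem_nhds hε),
      nhdsWithin_le_nhds (Metric.ball_mem_nhds (0 : ℂ) one_pos)] with h h1 h2 w hw
    rw [dist_comm, dist_eq_norm]
    exact (hB w hw h h2).trans_lt h1
  refine hunif.tendstoLocallyUniformlyOn.differentiableOn ?_ Metric.isOpen_ball
  filter_upwards [self_mem_nhdsWithin,
    nhdsWithin_le_nhds (Metric.ball_mem_nhds (0 : ℂ) one_pos)] with h h1 h2
  exact hne h h2 h1

/-- The coefficient of `z₁ᵏ z₂ˡ` in the power series of `f`. -/
def taylorCoef2 (f : ℂ × ℂ → ℂ) (k : ℕ × ℕ) : ℂ :=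
  taylorCoef (fun w => taylorCoef (fun z => f (z, w)) k.1) k.2

lemma iterate_backwardShift1 (k : ℕ) (f : ℂ × ℂ → ℂ) (z w : ℂ) :
    (backwardShift1^[k] f) (z, w) = (Function.swap dslope 0)^[k] (fun u => f (u, w)) z := by
  induction k generalizing f with
  | zero => rfl
  | succ k ih => rw [Function.iterate_succ_apply, Function.iterate_succ_apply, ih]; rfl

lemma differentiableOn_taylorCoef {f : ℂ × ℂ → ℂ} (hf : SeparatelyHolomorphic f)
    (hb : BoundedOnBidisk f) (k : ℕ) :
    DifferentiableOn ℂ (fun w => taylorCoef (fun z => f (z, w)) k) (Metric.ball 0 1) := by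
  have h : SeparatelyHolomorphic (backwardShift1^[k] f) ∧
      BoundedOnBidisk (backwardShift1^[k] f) := by
    induction k with
    | zero => exact ⟨hf, hb⟩
    | succ k ih =>
      rw [Function.iterate_succ_apply']
      exact ⟨ih.1.backwardShift1 ih.2, ih.2.backwardShift1 ih.1⟩
  simpa only [iterate_backwardShift1] using! h.1.right 0 (Metric.mem_ball_self one_pos)

lemma norm_taylorCoef2_le {f : ℂ × ℂ → ℂ} (hf : SeparatelyHolomorphic f) {C : ℝ}
    (hC : ∀ z ∈ bidisk, ‖f z‖ ≤ C) (k : ℕ × ℕ) : ‖taylorCoef2 f k‖ ≤ C :=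
  norm_taylorCoef_le (differentiableOn_taylorCoef hf ⟨C, hC⟩ k.1)
    (fun w hw => norm_taylorCoef_le (hf.left w hw) (fun _ hz => hC _ (mk_mem_bidisk hz hw)) k.1) k.2

lemma summable_geometric_bidisk {z : ℂ × ℂ} (hz : z ∈ bidisk) :
    Summable fun k : ℕ × ℕ => ‖z.1‖ ^ k.1 * ‖z.2‖ ^ k.2 :=
  (summable_geometric_of_lt_one (norm_nonneg _) hz.1).mul_of_nonneg
    (summable_geometric_of_lt_one (norm_nonneg _) hz.2)
    (fun _ => by positivity) (fun _ => by positivity)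

lemma summable_powerSeries {a : ℕ × ℕ → ℂ} {C : ℝ} (ha : ∀ k, ‖a k‖ ≤ C) {z : ℂ × ℂ}
    (hz : z ∈ bidisk) : Summable fun k => a k * z.1 ^ k.1 * z.2 ^ k.2 := by
  refine .of_norm_bounded ((summable_geometric_bidisk hz).mul_left C) fun k => ?_
  rw [norm_mul, norm_mul, norm_pow, norm_pow, mul_assoc]
  gcongr
  exact ha k

lemma hasSum_taylorCoef2 {f : ℂ × ℂ → ℂ} (hf : SeparatelyHolomorphic f)
    (hb : BoundedOnBidisk f) {z : ℂ × ℂ} (hz : z ∈ bidisk) :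
    HasSum (fun k : ℕ × ℕ => taylorCoef2 f k * z.1 ^ k.1 * z.2 ^ k.2) (f z) := by
  obtain ⟨C, hC⟩ := hb
  have hz1 : z.1 ∈ Metric.ball (0 : ℂ) 1 := mem_ball_zero_iff.2 hz.1
  have hz2 : z.2 ∈ Metric.ball (0 : ℂ) 1 := mem_ball_zero_iff.2 hz.2
  have hs := (summable_powerSeries (norm_taylorCoef2_le hf hC) hz).hasSum
  have hfib := HasSum.prod_fiberwise hs
    (g := fun k => taylorCoef (fun u => f (u, z.2)) k * z.1 ^ k) fun k => by
      refine ((hasSum_taylorCoef (differentiableOn_taylorCoef hf ⟨C, hC⟩ k) hz2).mul_right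
        (z.1 ^ k)).congr_fun fun l => ?_
      simp only [taylorCoef2]
      ring
  have h := hfib.unique (hasSum_taylorCoef (hf.left z.2 hz2) hz1)
  rwa [h] at hs

/-! ### Fourier series on the two-torus -/

/-- The monomial `ζ ↦ ζⁿ` in `L²(𝕋²)`. -/
def monomial (n : Fin 2 → ℤ) : L2T :=
  ContinuousMap.toLp (E := ℂ) 2 torusMeasure ℂ (UnitAddTorus.mFourier n)

lemma coeFn_monomial (n : Fin 2 → ℤ) : monomial n =ᵐ[torusMeasure] UnitAddTorus.mFourier n :=
  ContinuousMap.coeFn_toLp _ _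

lemma orthonormal_monomial : Orthonormal ℂ monomial :=
  UnitAddTorus.orthonormal_mFourier

/-- The monomials as a Hilbert basis of `L²(𝕋²)`. -/
def monomialBasis : HilbertBasis (Fin 2 → ℤ) ℂ L2T := UnitAddTorus.mFourierBasis

lemma monomialBasis_apply (n : Fin 2 → ℤ) : monomialBasis n = monomial n :=
  congrFun UnitAddTorus.coe_mFourierBasis n

lemma inner_monomial (n : Fin 2 → ℤ) (f : L2T) : inner ℂ (monomial n) f = fourierCoef f n :=
  (fourierCoef_eq_inner n f).symm

lemma hasSum_fourierCoef_smul (f : L2T) : HasSum (fun n => fourierCoef f n • monomial n) f := by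
  simpa only [monomialBasis.repr_apply_apply, monomialBasis_apply, inner_monomial] using
    monomialBasis.hasSum_repr f

lemma ext_fourierCoef {f g : L2T} (h : ∀ n, fourierCoef f n = fourierCoef g n) : f = g := by
  refine (hasSum_fourierCoef_smul f).unique ?_
  simpa only [h] using hasSum_fourierCoef_smul g

lemma norm_fourierCoef_le (f : L2T) (n : Fin 2 → ℤ) : ‖fourierCoef f n‖ ≤ ‖f‖ := by
  rw [← inner_monomial]
  simpa [orthonormal_monomial.1 n] using norm_inner_le_norm (𝕜 := ℂ) (monomial n) f

lemma fourierCoef_congr {f g : Torus → ℂ} (h : f =ᵐ[torusMeasure] g) (n : Fin 2 → ℤ) :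
    fourierCoef f n = fourierCoef g n :=
  integral_congr_ae (by filter_upwards [h] with x hx; rw [hx])

lemma _root_.Orthonormal.norm_sq_eq_tsum {ι E : Type*} [NormedAddCommGroup E]
    [InnerProductSpace ℂ E] {e : ι → E} (he : Orthonormal ℂ e) {c : ι → ℂ} {v : E}
    (h : HasSum (fun i => c i • e i) v) : ‖v‖ ^ 2 = ∑' i, ‖c i‖ ^ 2 := by
  classical
  have hc : ∀ i, inner ℂ (e i) v = c i := fun i => by
    have h1 := h.mapL (innerSL ℂ (e i))
    refine h1.unique ?_
    convert! hasSum_ite_eq i (c i) using 2 with j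
    rw [innerSL_apply_apply, inner_smul_right, orthonormal_iff_ite.1 he]
    by_cases hij : i = j
    · rw [if_pos hij, if_pos hij.symm, mul_one, hij]
    · rw [if_neg hij, if_neg (Ne.symm hij), mul_zero]
  have h2 := (h.mapL (innerSL ℂ v)).mapL Complex.reCLM
  simp only [innerSL_apply_apply, inner_smul_right, Complex.reCLM_apply] at h2
  have h3 : ∀ i, (c i * inner ℂ v (e i)).re = ‖c i‖ ^ 2 := fun i => by
    rw [← inner_conj_symm, hc, Complex.mul_conj, Complex.ofReal_re, Complex.normSq_eq_norm_sq]
  simp only [h3] at h2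
  rw [h2.tsum_eq, ← inner_self_eq_norm_sq (𝕜 := ℂ) v]
  rfl

/-- The exponents of the holomorphic monomials `z₁ᵏ z₂ˡ`. -/
def natFreq (k : ℕ × ℕ) : Fin 2 → ℤ := ![(k.1 : ℤ), (k.2 : ℤ)]

lemma natFreq_injective : Function.Injective natFreq := fun k l h => by
  have h0 := congrFun h 0
  have h1 := congrFun h 1
  simp only [natFreq, Matrix.cons_val_zero, Matrix.cons_val_one, Nat.cast_inj] at h0 h1
  exact Prod.ext h0 h1

lemma mem_range_natFreq {n : Fin 2 → ℤ} : n ∈ Set.range natFreq ↔ 0 ≤ n 0 ∧ 0 ≤ n 1 := by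
  constructor
  · rintro ⟨k, rfl⟩
    simp [natFreq]
  · rintro ⟨h0, h1⟩
    refine ⟨((n 0).toNat, (n 1).toNat), funext fun i => ?_⟩
    fin_cases i <;> simp [natFreq, h0, h1]

lemma mFourier_natFreq (k : ℕ × ℕ) (x : Torus) :
    UnitAddTorus.mFourier (natFreq k) x = (torusPt x).1 ^ k.1 * (torusPt x).2 ^ k.2 := by
  simp [UnitAddTorus.mFourier, natFreq, torusPt, fourier_apply, Fin.prod_univ_two,
    AddCircle.toCircle_nsmul]

lemma fourierCoef_of_hasSum {ι : Type*} {c : ι → ℂ} {e : ι → Fin 2 → ℤ} {F : L2T}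
    (h : HasSum (fun i => c i • monomial (e i)) F) (n : Fin 2 → ℤ) :
    HasSum (fun i => if e i = n then c i else 0) (fourierCoef F n) := by
  rw [← inner_monomial]
  refine (h.mapL (innerSL ℂ (monomial n))).congr_fun fun i => ?_
  simp only [innerSL_apply_apply, inner_smul_right, orthonormal_iff_ite.1 orthonormal_monomial]
  simp [eq_comm]

lemma fourierCoef_natFreq_of_hasSum {c : ℕ × ℕ → ℂ} {F : L2T}
    (h : HasSum (fun k => c k • monomial (natFreq k)) F) (k : ℕ × ℕ) :
    fourierCoef F (natFreq k) = c k := by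
  refine (fourierCoef_of_hasSum h (natFreq k)).unique ?_
  simp only [natFreq_injective.eq_iff]
  convert hasSum_ite_eq k (c k)

lemma mem_H2_of_hasSum {c : ℕ × ℕ → ℂ} {F : L2T}
    (h : HasSum (fun k => c k • monomial (natFreq k)) F) : F ∈ H2 := by
  intro n hn
  refine (fourierCoef_of_hasSum h n).unique ?_
  have : ∀ k, natFreq k ≠ n := fun k hk => hn (mem_range_natFreq.1 ⟨k, hk⟩)
  simp [this]

/-! ### Dilations and boundary functions -/

lemma smul_torusPt_mem_bidisk {r : ℝ} (hr0 : 0 ≤ r) (hr1 : r < 1) (x : Torus) :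
    r • torusPt x ∈ bidisk := by
  simp [bidisk, torusPt, abs_of_nonneg hr0, hr1, Circle.norm_coe]

/-- The dilation `ζ ↦ f(rζ)` of a function given by a power series on the bidisk has the Fourier
coefficients `aₖₗ rᵏ⁺ˡ`. -/
lemma exists_dilation {f : ℂ × ℂ → ℂ} {a : ℕ × ℕ → ℂ} {C : ℝ} (ha : ∀ k, ‖a k‖ ≤ C)
    (hf : ∀ z ∈ bidisk, HasSum (fun k : ℕ × ℕ => a k * z.1 ^ k.1 * z.2 ^ k.2) (f z))
    {r : ℝ} (hr0 : 0 ≤ r) (hr1 : r < 1) :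
    ∃ p : C(Torus, ℂ), (∀ x, p x = f (r • torusPt x)) ∧
      HasSum (fun k => (a k * (r : ℂ) ^ (k.1 + k.2)) • monomial (natFreq k))
        (ContinuousMap.toLp (E := ℂ) 2 torusMeasure ℂ p) := by
  have hs : Summable fun k : ℕ × ℕ =>
      (a k * (r : ℂ) ^ (k.1 + k.2)) • UnitAddTorus.mFourier (natFreq k) := by
    have hr : ((r : ℂ), (r : ℂ)) ∈ bidisk := by simp [bidisk, abs_of_nonneg hr0, hr1]
    refine .of_norm_bounded ((summable_geometric_bidisk hr).mul_left C) fun k => ?_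
    rw [norm_smul, UnitAddTorus.mFourier_norm, mul_one, norm_mul, norm_pow, pow_add]
    gcongr
    exact ha k
  refine ⟨_, fun x => ?_, hs.hasSum.mapL (ContinuousMap.toLp (E := ℂ) 2 torusMeasure ℂ) |>.congr_fun
    fun k => ?_⟩
  · refine (hs.hasSum.mapL (ContinuousMap.evalCLM ℂ x)).unique
      ((hf _ (smul_torusPt_mem_bidisk hr0 hr1 x)).congr_fun fun k => ?_)
    simp only [ContinuousMap.evalCLM_apply, ContinuousMap.smul_apply, mFourier_natFreq,
      Prod.smul_fst, Prod.smul_snd, Complex.real_smul, smul_eq_mul]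
    ring
  · simp [monomial]

/-- A sequence of radii increasing to `1`. -/
def radius (j : ℕ) : ℝ := 1 - 1 / ((j : ℝ) + 1)

lemma radius_nonneg (j : ℕ) : 0 ≤ radius j := by
  have : 1 / ((j : ℝ) + 1) ≤ 1 := by
    rw [div_le_one (by positivity)]
    linarith [(Nat.cast_nonneg j : (0 : ℝ) ≤ j)]
  rw [radius]
  linarith

lemma radius_lt_one (j : ℕ) : radius j < 1 := by
  have : 0 < 1 / ((j : ℝ) + 1) := by positivity
  rw [radius]
  linarith

lemma tendsto_radius : Tendsto radius atTop (𝓝 1) := by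
  simpa only [sub_zero] using! (tendsto_one_div_add_atTop_nhds_zero_nat (𝕜 := ℝ)).const_sub 1

lemma tendsto_ofReal_radius : Tendsto (fun j => (radius j : ℂ)) atTop (𝓝 1) :=
  (Complex.continuous_ofReal.tendsto 1).comp tendsto_radius

lemma tendstoInMeasure_dilation {f : ℂ × ℂ → ℂ} {a : ℕ × ℕ → ℂ} {F : L2T}
    (hf : ∀ z ∈ bidisk, HasSum (fun k : ℕ × ℕ => a k * z.1 ^ k.1 * z.2 ^ k.2) (f z))
    (ha : Summable fun k => ‖a k‖ ^ 2)
    (hF : HasSum (fun k => a k • monomial (natFreq k)) F) :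
    TendstoInMeasure torusMeasure (fun j x => f (radius j • torusPt x)) atTop F := by
  have hb : ∀ k, ‖a k‖ ≤ ‖F‖ := fun k => by
    rw [← fourierCoef_natFreq_of_hasSum hF k]
    exact norm_fourierCoef_le _ _
  choose p hp hps using fun j => exists_dilation hb hf (radius_nonneg j) (radius_lt_one j)
  set P : ℕ → L2T := fun j => ContinuousMap.toLp (E := ℂ) 2 torusMeasure ℂ (p j) with hP
  have hnorm : ∀ j, ‖P j - F‖ ^ 2 = ∑' k, ‖a k * (radius j : ℂ) ^ (k.1 + k.2) - a k‖ ^ 2 :=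
    fun j => (orthonormal_monomial.comp _ natFreq_injective).norm_sq_eq_tsum
      (((hps j).sub hF).congr_fun fun k => by simp [sub_smul])
  have hlim : Tendsto (fun j => ‖P j - F‖ ^ 2) atTop (𝓝 0) := by
    simp only [hnorm]
    rw [show (0 : ℝ) = ∑' _ : ℕ × ℕ, (0 : ℝ) by simp]
    refine tendsto_tsum_of_dominated_convergence ha (fun k => ?_) (.of_forall fun j k => ?_)
    · have h1 := (tendsto_ofReal_radius.pow (k.1 + k.2)).const_mul (a k)
      have h2 := (h1.sub_const (a k)).norm.pow 2
      simpa using h2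
    · have h1 : a k * (radius j : ℂ) ^ (k.1 + k.2) - a k
          = a k * ((radius j ^ (k.1 + k.2) - 1 : ℝ) : ℂ) := by push_cast; ring
      have h2 : ‖((radius j ^ (k.1 + k.2) - 1 : ℝ) : ℂ)‖ ≤ 1 := by
        rw [Complex.norm_real, Real.norm_eq_abs, abs_le]
        have := pow_nonneg (radius_nonneg j) (k.1 + k.2)
        have := pow_le_one₀ (n := k.1 + k.2) (radius_nonneg j) (radius_lt_one j).le
        constructor <;> linarith
      rw [h1, norm_pow, norm_norm, norm_mul]
      gcongr
      exact mul_le_of_le_one_right (norm_nonneg _) h2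
  have hlim' : Tendsto P atTop (𝓝 F) := by
    rw [tendsto_iff_norm_sub_tendsto_zero]
    simpa using hlim.sqrt
  refine (tendstoInMeasure_of_tendsto_Lp hlim').congr_left fun j => ?_
  filter_upwards [ContinuousMap.coeFn_toLp (p := 2) (𝕜 := ℂ) torusMeasure (p j)] with x hx
  rw [hP, hx, hp]

/-- The power series of a bounded function has square summable coefficients, by Bessel's inequality
for its dilations. -/
lemma summable_norm_sq_of_bounded {f : ℂ × ℂ → ℂ} {a : ℕ × ℕ → ℂ} {C : ℝ} (ha : ∀ k, ‖a k‖ ≤ C)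
    (hf : ∀ z ∈ bidisk, HasSum (fun k : ℕ × ℕ => a k * z.1 ^ k.1 * z.2 ^ k.2) (f z))
    (hC : ∀ z ∈ bidisk, ‖f z‖ ≤ C) : Summable fun k => ‖a k‖ ^ 2 := by
  refine summable_of_sum_le (c := C ^ 2) (fun k => by positivity) fun u => ?_
  have key : ∀ j, ∑ k ∈ u, ‖a k * (radius j : ℂ) ^ (k.1 + k.2)‖ ^ 2 ≤ C ^ 2 := by
    intro j
    obtain ⟨p, hp, hps⟩ := exists_dilation ha hf (radius_nonneg j) (radius_lt_one j)
    set P : L2T := ContinuousMap.toLp (E := ℂ) 2 torusMeasure ℂ p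
    have h1 : ‖P‖ ≤ C := by
      have hC0 : 0 ≤ C := (norm_nonneg _).trans (ha 0)
      have h := Lp.norm_le_of_ae_bound (p := 2) (f := P) hC0 (C := C) (by
        filter_upwards [ContinuousMap.coeFn_toLp (p := 2) (𝕜 := ℂ) torusMeasure p] with x hx
        rw [hx, hp]
        exact hC _ (smul_torusPt_mem_bidisk (radius_nonneg j) (radius_lt_one j) x))
      simpa [measureUnivNNReal] using h
    have h2 := (orthonormal_monomial.comp _ natFreq_injective).sum_inner_products_le P (s := u)
    simp only [Function.comp_apply, inner_monomial, fourierCoef_natFreq_of_hasSum hps] at h2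
    exact h2.trans (by gcongr)
  have hlim : Tendsto (fun j => ∑ k ∈ u, ‖a k * (radius j : ℂ) ^ (k.1 + k.2)‖ ^ 2) atTop
      (𝓝 (∑ k ∈ u, ‖a k‖ ^ 2)) := by
    refine tendsto_finsetSum _ fun k _ => ?_
    simpa using ((tendsto_ofReal_radius.pow (k.1 + k.2)).const_mul (a k)).norm.pow 2
  exact le_of_tendsto' hlim key

/-- Bounded holomorphic functions have boundary functions, which are limits in measure of the
dilations and therefore obey the same bound. -/
lemma exists_isBoundaryFunction {f : ℂ × ℂ → ℂ} (hf : SeparatelyHolomorphic f) {C : ℝ}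
    (hC : ∀ z ∈ bidisk, ‖f z‖ ≤ C) :
    ∃ F : LInfT, IsBoundaryFunction f F ∧
      (∀ k, fourierCoef F (natFreq k) = taylorCoef2 f k) ∧
      (∀ᵐ x ∂torusMeasure, ‖F x‖ ≤ C) ∧
      TendstoInMeasure torusMeasure (fun j x => f (radius j • torusPt x)) atTop F := by
  have ha := norm_taylorCoef2_le hf hC
  have hsum : ∀ z ∈ bidisk, HasSum
      (fun k : ℕ × ℕ => taylorCoef2 f k * z.1 ^ k.1 * z.2 ^ k.2) (f z) :=
    fun z hz => hasSum_taylorCoef2 hf ⟨C, hC⟩ hz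
  have hsq := summable_norm_sq_of_bounded ha hsum hC
  obtain ⟨G, hG⟩ : Summable fun k => taylorCoef2 f k • monomial (natFreq k) := by
    have := (orthonormal_monomial.comp _ natFreq_injective).orthogonalFamily
    simpa using (this.summable_iff_norm_sq_summable (taylorCoef2 f)).2 hsq
  have hm := tendstoInMeasure_dilation hsum hsq hG
  have hbd : ∀ᵐ x ∂torusMeasure, ‖G x‖ ≤ C := by
    obtain ⟨ns, -, hns⟩ := hm.exists_seq_tendsto_ae
    filter_upwards [hns] with x hx
    exact le_of_tendsto' hx.norm fun i =>
      hC _ (smul_torusPt_mem_bidisk (radius_nonneg _) (radius_lt_one _) x)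
  have hmem : MemLp G ∞ torusMeasure := memLp_top_of_bound (Lp.aestronglyMeasurable G) C hbd
  have hae := hmem.coeFn_toLp
  have h0 : ∀ n : Fin 2 → ℤ, ¬ (0 ≤ n 0 ∧ 0 ≤ n 1) → fourierCoef (hmem.toLp G) n = 0 :=
    fun n hn => (fourierCoef_congr hae n).trans (mem_H2_of_hasSum hG n hn)
  have h1 : ∀ k, fourierCoef (hmem.toLp G) (natFreq k) = taylorCoef2 f k :=
    fun k => (fourierCoef_congr hae _).trans (fourierCoef_natFreq_of_hasSum hG k)
  refine ⟨hmem.toLp G, ⟨h0, fun z hz => ?_⟩, h1, ?_, hm.congr_right hae.symm⟩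
  · exact (hsum z hz).congr_fun fun k => by rw [← h1]; rfl
  · filter_upwards [hae, hbd] with x hx hx'
    rwa [hx]

lemma memLp_two (F : LInfT) : MemLp F 2 torusMeasure := (Lp.memLp F).mono_exponent le_top

/-- The Fourier coefficients of a boundary function are determined by the function on the bidisk,
since they can be read off from a dilation. -/
lemma IsBoundaryFunction.ae_eq {f : ℂ × ℂ → ℂ} {F G : Torus → ℂ} (hF : IsBoundaryFunction f F)
    (hG : IsBoundaryFunction f G) (hF2 : MemLp F 2 torusMeasure) (hG2 : MemLp G 2 torusMeasure) :
    F =ᵐ[torusMeasure] G := by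
  suffices h : hF2.toLp F = hG2.toLp G from
    hF2.coeFn_toLp.symm.trans ((Lp.ext_iff.1 h).trans hG2.coeFn_toLp)
  refine ext_fourierCoef fun n => ?_
  have hbd : ∀ (H : Torus → ℂ) (hH2 : MemLp H 2 torusMeasure) (k : ℕ × ℕ),
      ‖fourierCoef H (natFreq k)‖ ≤ ‖hH2.toLp H‖ := fun H hH2 k =>
    (fourierCoef_congr hH2.coeFn_toLp (natFreq k)) ▸ norm_fourierCoef_le _ _
  rw [fourierCoef_congr hF2.coeFn_toLp, fourierCoef_congr hG2.coeFn_toLp]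
  by_cases hn : 0 ≤ n 0 ∧ 0 ≤ n 1
  · obtain ⟨k, rfl⟩ := mem_range_natFreq.2 hn
    obtain ⟨p, hp, hps⟩ := exists_dilation (hbd F hF2) hF.2 (r := 1 / 2) (by norm_num) (by norm_num)
    obtain ⟨q, hq, hqs⟩ := exists_dilation (hbd G hG2) hG.2 (r := 1 / 2) (by norm_num) (by norm_num)
    have hpq : p = q := ContinuousMap.ext fun x => by rw [hp, hq]
    subst hpq
    have h := (fourierCoef_natFreq_of_hasSum hps k).symm.trans (fourierCoef_natFreq_of_hasSum hqs k)
    exact mul_right_cancel₀ (pow_ne_zero _ (by norm_num)) h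
  · rw [hF.1 n hn, hG.1 n hn]

/-! ### Boundary functions of products and of inner functions -/

/-- Bounded functions on the bidisk, holomorphic in each variable. -/
structure IsHInf (f : ℂ × ℂ → ℂ) : Prop where
  holo : SeparatelyHolomorphic f
  bdd : BoundedOnBidisk f

lemma IsInner.isHInf {φ : ℂ × ℂ → ℂ} (hφ : IsInner φ) : IsHInf φ :=
  ⟨hφ.holomorphic.separatelyHolomorphic, hφ.bounded⟩

lemma IsHInf.mul {f g : ℂ × ℂ → ℂ} (hf : IsHInf f) (hg : IsHInf g) :
    IsHInf fun z => f z * g z := by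
  obtain ⟨C, hC⟩ := hf.bdd
  obtain ⟨D, hD⟩ := hg.bdd
  refine ⟨⟨fun w hw => (hf.holo.left w hw).mul (hg.holo.left w hw),
    fun z hz => (hf.holo.right z hz).mul (hg.holo.right z hz)⟩, C * D, fun z hz => ?_⟩
  rw [norm_mul]
  exact mul_le_mul (hC z hz) (hD z hz) (norm_nonneg _) ((norm_nonneg _).trans (hC z hz))

lemma IsHInf.pow {f : ℂ × ℂ → ℂ} (hf : IsHInf f) (n : ℕ) : IsHInf fun z => f z ^ n := by
  obtain ⟨C, hC⟩ := hf.bdd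
  refine ⟨⟨fun w hw => (hf.holo.left w hw).pow n, fun z hz => (hf.holo.right z hz).pow n⟩,
    C ^ n, fun z hz => ?_⟩
  rw [norm_pow]
  gcongr
  exact hC z hz

lemma IsHInf.backwardShift1 {f : ℂ × ℂ → ℂ} (hf : IsHInf f) : IsHInf (backwardShift1 f) :=
  ⟨hf.holo.backwardShift1 hf.bdd, hf.bdd.backwardShift1 hf.holo⟩

lemma zero_mk_mem_bidisk {z : ℂ × ℂ} (hz : z ∈ bidisk) : ((0 : ℂ), z.2) ∈ bidisk :=
  ⟨by simp, hz.2⟩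

/-- The restriction of `f` to `z₁ = 0`, as a function on the bidisk. -/
def sliceZero (f : ℂ × ℂ → ℂ) (z : ℂ × ℂ) : ℂ := f (0, z.2)

lemma IsHInf.sliceZero {f : ℂ × ℂ → ℂ} (hf : IsHInf f) : IsHInf (sliceZero f) := by
  obtain ⟨C, hC⟩ := hf.bdd
  exact ⟨⟨fun w _ => differentiableOn_const (f (0, w)),
    fun z _ => hf.holo.right 0 (Metric.mem_ball_self one_pos)⟩,
    C, fun z hz => hC _ (zero_mk_mem_bidisk hz)⟩

lemma boundaryInf_spec {f : ℂ × ℂ → ℂ} (hf : IsHInf f) :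
    IsBoundaryFunction f (boundaryInf f) := by
  obtain ⟨C, hC⟩ := hf.bdd
  obtain ⟨F, hF, -⟩ := exists_isBoundaryFunction hf.holo hC
  have h : ∃ F : LInfT, IsBoundaryFunction f F := ⟨F, hF⟩
  rw [boundaryInf, dif_pos h]
  exact h.choose_spec

lemma boundaryInf_eq {f : ℂ × ℂ → ℂ} (hf : IsHInf f) {F : LInfT} (hF : IsBoundaryFunction f F) :
    boundaryInf f = F :=
  Lp.ext ((boundaryInf_spec hf).ae_eq hF (memLp_two _) (memLp_two _))

lemma norm_boundaryInf_le {f : ℂ × ℂ → ℂ} (hf : IsHInf f) {C : ℝ} (hC : ∀ z ∈ bidisk, ‖f z‖ ≤ C) :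
    ∀ᵐ x ∂torusMeasure, ‖boundaryInf f x‖ ≤ C := by
  obtain ⟨F, hF, -, hb, -⟩ := exists_isBoundaryFunction hf.holo hC
  rwa [boundaryInf_eq hf hF]

lemma tendstoInMeasure_boundaryInf {f : ℂ × ℂ → ℂ} (hf : IsHInf f) :
    TendstoInMeasure torusMeasure (fun j x => f (radius j • torusPt x)) atTop (boundaryInf f) := by
  obtain ⟨C, hC⟩ := hf.bdd
  obtain ⟨F, hF, -, -, hm⟩ := exists_isBoundaryFunction hf.holo hC
  rwa [boundaryInf_eq hf hF]

lemma fourierCoef_boundaryInf {f : ℂ × ℂ → ℂ} (hf : IsHInf f) (k : ℕ × ℕ) :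
    fourierCoef (boundaryInf f) (natFreq k) = taylorCoef2 f k := by
  obtain ⟨C, hC⟩ := hf.bdd
  obtain ⟨F, hF, h, -⟩ := exists_isBoundaryFunction hf.holo hC
  rw [boundaryInf_eq hf hF, h]

/-- Along a suitable sequence of radii, the radial limits of finitely many bounded holomorphic
functions exist almost everywhere and are their boundary functions. Algebraic identities between
functions on the bidisk therefore hold between their boundary functions. -/
lemma exists_seq_tendsto_boundaryInf (s : Finset (ℂ × ℂ → ℂ)) (hs : ∀ f ∈ s, IsHInf f) :
    ∃ ns : ℕ → ℕ, StrictMono ns ∧ ∀ᵐ x ∂torusMeasure, ∀ f ∈ s,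
      Tendsto (fun i => f (radius (ns i) • torusPt x)) atTop (𝓝 (boundaryInf f x)) := by
  classical
  induction s using Finset.induction_on with
  | empty => exact ⟨id, strictMono_id, by simp⟩
  | insert f s _ ih =>
    obtain ⟨ns, hns, h⟩ := ih fun g hg => hs g (Finset.mem_insert_of_mem hg)
    obtain ⟨ms, hms, h'⟩ := ((tendstoInMeasure_boundaryInf
      (hs f (Finset.mem_insert_self f s))).comp hns.tendsto_atTop).exists_seq_tendsto_ae
    refine ⟨ns ∘ ms, hns.comp hms, ?_⟩
    filter_upwards [h, h'] with x hx hx' g hg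
    rcases Finset.mem_insert.1 hg with rfl | hg
    · exact hx'
    · exact (hx g hg).comp hms.tendsto_atTop

lemma tendsto_radius_smul (x : Torus) :
    Tendsto (fun j => radius j • torusPt x) atTop (𝓝 (torusPt x)) := by
  simpa using tendsto_radius.smul_const (torusPt x)

lemma boundaryInf_mul {f g : ℂ × ℂ → ℂ} (hf : IsHInf f) (hg : IsHInf g) :
    boundaryInf (fun z => f z * g z) =ᵐ[torusMeasure]
      fun x => boundaryInf f x * boundaryInf g x := by
  classical
  obtain ⟨ns, -, h⟩ := exists_seq_tendsto_boundaryInf {f, g, fun z => f z * g z} (by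
    simp only [Finset.mem_insert, Finset.mem_singleton]
    rintro _ (rfl | rfl | rfl)
    exacts [hf, hg, hf.mul hg])
  filter_upwards [h] with x hx
  simp only [Finset.mem_insert, Finset.mem_singleton, forall_eq_or_imp, forall_eq] at hx
  exact tendsto_nhds_unique hx.2.2 (hx.1.mul hx.2.1)

lemma eqOn_bidisk_of_boundaryInf {f g : ℂ × ℂ → ℂ} (hf : IsHInf f) (hg : IsHInf g)
    (h : boundaryInf f =ᵐ[torusMeasure] boundaryInf g) : Set.EqOn f g bidisk := fun z hz => by
  have h' := Lp.ext h
  refine ((boundaryInf_spec hf).2 z hz).unique ?_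
  rw [h']
  exact (boundaryInf_spec hg).2 z hz

/-- Each power of `f` has Fourier coefficients of modulus at most `1`, so the powers of `f(z)` are
bounded. -/
lemma norm_le_one_of_boundaryInf {f : ℂ × ℂ → ℂ} (hf : IsHInf f)
    (h : ∀ᵐ x ∂torusMeasure, ‖boundaryInf f x‖ ≤ 1) {z : ℂ × ℂ} (hz : z ∈ bidisk) : ‖f z‖ ≤ 1 := by
  have hbd : ∀ n : ℕ, ∀ᵐ x ∂torusMeasure, ‖boundaryInf (fun z => f z ^ n) x‖ ≤ 1 := by
    intro n
    induction n with
    | zero => exact norm_boundaryInf_le (hf.pow 0) fun z _ => by simp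
    | succ n ih =>
      simp only [pow_succ]
      filter_upwards [boundaryInf_mul (hf.pow n) hf, h, ih] with x hx h1 h2
      rw [hx, norm_mul]
      exact mul_le_one₀ h2 (norm_nonneg _) h1
  have hcoef : ∀ (n : ℕ) (k : Fin 2 → ℤ), ‖fourierCoef (boundaryInf fun z => f z ^ n) k‖ ≤ 1 := by
    intro n k
    have := norm_integral_le_of_norm_le_const (μ := torusMeasure) (C := 1)
      (f := fun x => UnitAddTorus.mFourier (-k) x * boundaryInf (fun z => f z ^ n) x) (by
        filter_upwards [hbd n] with x hx
        rw [norm_mul]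
        refine mul_le_one₀ ?_ (norm_nonneg _) hx
        exact ((UnitAddTorus.mFourier (-k)).norm_coe_le_norm x).trans_eq UnitAddTorus.mFourier_norm)
    simpa [fourierCoef] using this
  by_contra! hlt
  obtain ⟨n, hn⟩ := pow_unbounded_of_one_lt (∑' k : ℕ × ℕ, ‖z.1‖ ^ k.1 * ‖z.2‖ ^ k.2) hlt
  refine absurd ?_ hn.not_ge
  rw [← norm_pow]
  have hsum := ((boundaryInf_spec (hf.pow n)).2 z hz).tsum_eq
  simp only at hsum
  rw [← hsum]
  refine tsum_of_norm_bounded (summable_geometric_bidisk hz).hasSum fun k => ?_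
  rw [norm_mul, norm_mul, norm_pow, norm_pow, mul_assoc]
  exact mul_le_of_le_one_left (by positivity) (hcoef n _)

/-- The radii at `ζ` lie in a nontangential approach region, so the nontangential limits of an inner
function are its boundary function. -/
lemma IsInner.norm_boundaryInf {φ : ℂ × ℂ → ℂ} (hφ : IsInner φ) :
    ∀ᵐ x ∂torusMeasure, ‖boundaryInf φ x‖ = 1 := by
  obtain ⟨ns, hns, h⟩ := (tendstoInMeasure_boundaryInf hφ.isHInf).exists_seq_tendsto_ae
  filter_upwards [h, hφ.unimodular] with x hx hc
  obtain ⟨c, hc1, hc⟩ := hc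
  have hst : ∀ j, radius j • torusPt x ∈ stolz 2 (torusPt x) := fun j => by
    have h0 := radius_nonneg j
    have h1 := radius_lt_one j
    have key : ∀ ζ : Circle,
        ‖radius j • (ζ : ℂ) - ζ‖ ≤ 2 * (1 - ‖radius j • (ζ : ℂ)‖) := fun ζ => by
      have h2 : radius j • (ζ : ℂ) - ζ = (radius j - 1) • (ζ : ℂ) := by rw [sub_smul, one_smul]
      rw [h2, norm_smul, norm_smul, Circle.norm_coe, Real.norm_eq_abs, Real.norm_eq_abs,
        abs_of_nonneg h0, abs_of_nonpos (by linarith)]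
      linarith
    exact ⟨smul_torusPt_mem_bidisk h0 h1 x, key _, key _⟩
  have hlim : Tendsto (fun i => φ (radius (ns i) • torusPt x)) atTop (𝓝 c) :=
    (hc 2 one_lt_two).comp (tendsto_nhdsWithin_iff.2
      ⟨(tendsto_radius_smul x).comp hns.tendsto_atTop, .of_forall fun i => hst _⟩)
  rw [tendsto_nhds_unique hx hlim, hc1]

lemma isOpen_bidisk : IsOpen bidisk :=
  (isOpen_lt (continuous_fst.norm) continuous_const).inter
    (isOpen_lt (continuous_snd.norm) continuous_const)

lemma isPreconnected_bidisk : IsPreconnected bidisk := by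
  have h : bidisk = Metric.ball (0 : ℂ) 1 ×ˢ Metric.ball (0 : ℂ) 1 := by
    ext z
    simp [bidisk]
  rw [h]
  exact ((convex_ball 0 1).prod (convex_ball 0 1)).isPreconnected

lemma IsInner.norm_le_one {φ : ℂ × ℂ → ℂ} (hφ : IsInner φ) {z : ℂ × ℂ} (hz : z ∈ bidisk) :
    ‖φ z‖ ≤ 1 :=
  norm_le_one_of_boundaryInf hφ.isHInf (hφ.norm_boundaryInf.mono fun _ hx => hx.le) hz

/-- By the maximum principle. -/
lemma IsInner.norm_lt_one {φ : ℂ × ℂ → ℂ} (hφ : IsInner φ)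
    (hne : ∃ z ∈ bidisk, ∃ w ∈ bidisk, φ z ≠ φ w) {z : ℂ × ℂ} (hz : z ∈ bidisk) : ‖φ z‖ < 1 := by
  refine lt_of_le_of_ne (hφ.norm_le_one hz) fun h => ?_
  have hc := Complex.eqOn_of_isPreconnected_of_isMaxOn_norm isPreconnected_bidisk isOpen_bidisk
    hφ.holomorphic hz fun w hw => by simpa [h] using hφ.norm_le_one hw
  obtain ⟨u, hu, w, hw, huw⟩ := hne
  exact huw ((hc hu).trans (hc hw).symm)

/-! ### Multiplication operators and projections -/

lemma coeFn_mulOp (b : LInfT) (g : L2T) : mulOp b g =ᵐ[torusMeasure] fun x => b x * g x :=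
  ContinuousLinearMap.coeFn_holder (r := 2) (ContinuousLinearMap.mul ℂ ℂ) b g

lemma coeFn_star (b : LInfT) :
    ((star b : LInfT) : Torus → ℂ) =ᵐ[torusMeasure] fun x => conj (b x) := by
  filter_upwards [Lp.coeFn_star b] with x hx
  rw [hx]
  rfl

lemma coeFn_coord1 : coord1 =ᵐ[torusMeasure] UnitAddTorus.mFourier ![1, 0] :=
  ContinuousMap.coeFn_toLp _ _

lemma inner_mulOp_star (b : LInfT) (f g : L2T) :
    inner ℂ (mulOp (star b) f) g = inner ℂ f (mulOp b g) := by
  rw [L2.inner_def, L2.inner_def]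
  refine integral_congr_ae ?_
  filter_upwards [coeFn_mulOp b g, coeFn_mulOp (star b) f, coeFn_star b] with x h1 h2 h3
  rw [h1, h2, h3, RCLike.inner_apply, RCLike.inner_apply, map_mul, Complex.conj_conj]
  ring

lemma norm_mulOp_le {b : LInfT} (hb : ∀ᵐ x ∂torusMeasure, ‖b x‖ ≤ 1) (f : L2T) :
    ‖mulOp b f‖ ≤ ‖f‖ := by
  refine Lp.norm_le_norm_of_ae_le ?_
  filter_upwards [hb, coeFn_mulOp b f] with x h1 h2
  rw [h2, norm_mul]
  exact mul_le_of_le_one_left (norm_nonneg _) h1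

lemma norm_mulOp_eq {b : LInfT} (hb : ∀ᵐ x ∂torusMeasure, ‖b x‖ = 1) (f : L2T) :
    ‖mulOp b f‖ = ‖f‖ := by
  refine le_antisymm (norm_mulOp_le (hb.mono fun x hx => hx.le) f) (Lp.norm_le_norm_of_ae_le ?_)
  filter_upwards [hb, coeFn_mulOp b f] with x h1 h2
  rw [h2, norm_mul, h1, one_mul]

/-- The boundary function of a bounded holomorphic function, as an element of `L²(𝕋²)`. -/
def boundaryTwo (f : ℂ × ℂ → ℂ) : L2T := mulOp (boundaryInf f) (monomial 0)

lemma coeFn_boundaryTwo (f : ℂ × ℂ → ℂ) : boundaryTwo f =ᵐ[torusMeasure] boundaryInf f := by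
  filter_upwards [coeFn_mulOp (boundaryInf f) (monomial 0), coeFn_monomial 0] with x h1 h2
  rw [boundaryTwo, h1, h2, UnitAddTorus.mFourier_zero, ContinuousMap.one_apply, mul_one]

lemma monomial_zero_mem_H2 : monomial 0 ∈ H2 := fun n hn => by
  rw [← inner_monomial, orthonormal_iff_ite.1 orthonormal_monomial, if_neg]
  rintro rfl
  exact hn ⟨le_rfl, le_rfl⟩

lemma fourierCoef_mulOp_monomial (b : LInfT) (m n : Fin 2 → ℤ) :
    fourierCoef (mulOp b (monomial m)) n = fourierCoef b (n - m) := by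
  refine integral_congr_ae ?_
  filter_upwards [coeFn_mulOp b (monomial m), coeFn_monomial m] with x h1 h2
  rw [h1, h2, neg_sub, sub_eq_add_neg, UnitAddTorus.mFourier_add]
  ring

lemma mulOp_mem_H2 {f : ℂ × ℂ → ℂ} (hf : IsHInf f) {G : L2T} (hG : G ∈ H2) :
    mulOp (boundaryInf f) G ∈ H2 := by
  intro n hn
  have h := ((hasSum_fourierCoef_smul G).mapL (mulOp (boundaryInf f))).mapL (innerSL ℂ (monomial n))
  simp only [map_smul, innerSL_apply_apply, inner_monomial, fourierCoef_mulOp_monomial] at h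
  refine h.unique ?_
  convert! hasSum_zero using 2 with m
  by_cases hm : 0 ≤ m 0 ∧ 0 ≤ m 1
  · have h0 : ¬ (0 ≤ (n - m) 0 ∧ 0 ≤ (n - m) 1) := fun h => hn (by
      simp only [Pi.sub_apply] at h
      exact ⟨by linarith, by linarith⟩)
    rw [(boundaryInf_spec hf).1 _ h0, smul_zero]
  · rw [hG m hm, zero_smul]

lemma boundaryTwo_mem_H2 {f : ℂ × ℂ → ℂ} (hf : IsHInf f) : boundaryTwo f ∈ H2 :=
  mulOp_mem_H2 hf monomial_zero_mem_H2

lemma fourierCoef_mulOp_coord1 (G : L2T) (n : Fin 2 → ℤ) :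
    fourierCoef (mulOp coord1 G) n = fourierCoef G (n - ![1, 0]) := by
  refine integral_congr_ae ?_
  filter_upwards [coeFn_mulOp coord1 G, coeFn_coord1] with x h1 h2
  rw [h1, h2, neg_sub, sub_eq_add_neg, UnitAddTorus.mFourier_add]
  ring

lemma mulOp_coord1_mem_orthogonal_H22 {G : L2T} (hG : G ∈ H2) : mulOp coord1 G ∈ H22ᗮ := by
  rw [Submodule.mem_orthogonal]
  intro y hy
  refine (monomialBasis.hasSum_inner_mul_inner y (mulOp coord1 G)).unique ?_
  convert! hasSum_zero using 2 with n
  rw [monomialBasis_apply, inner_monomial, fourierCoef_mulOp_coord1, ← inner_conj_symm,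
    inner_monomial]
  by_cases hn : n 0 = 0 ∧ 0 ≤ n 1
  · rw [hG _ fun h => absurd h.1 (by simp only [Pi.sub_apply, hn.1]; simp), mul_zero]
  · rw [hy n hn, map_zero, zero_mul]

lemma taylorCoef_const {c : ℂ} {n : ℕ} (hn : n ≠ 0) : taylorCoef (fun _ => c) n = 0 := by
  rw [taylorCoef_eq (differentiableOn_const _), iteratedDeriv_const, if_neg hn, zero_div]

lemma boundaryTwo_sliceZero_mem_H22 {f : ℂ × ℂ → ℂ} (hf : IsHInf f) :
    boundaryTwo (sliceZero f) ∈ H22 := by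
  intro n hn
  rw [fourierCoef_congr (coeFn_boundaryTwo _)]
  by_cases h : 0 ≤ n 0 ∧ 0 ≤ n 1
  · obtain ⟨k, rfl⟩ := mem_range_natFreq.2 h
    have hk : k.1 ≠ 0 := fun h0 => hn ⟨by simp [natFreq, h0], h.2⟩
    rw [fourierCoef_boundaryInf hf.sliceZero, taylorCoef2]
    simp only [sliceZero, taylorCoef_const hk]
    rcases eq_or_ne k.2 0 with h0 | h0
    · rw [h0]
      rfl
    · exact taylorCoef_const h0
  · exact (boundaryInf_spec hf.sliceZero).1 n h

lemma mFourier_one_zero (x : Torus) : UnitAddTorus.mFourier ![1, 0] x = (torusPt x).1 := by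
  simpa [natFreq] using mFourier_natFreq (1, 0) x

lemma tendsto_radius_smul_fst {ns : ℕ → ℕ} (hns : StrictMono ns) (x : Torus) :
    Tendsto (fun i => (radius (ns i) • torusPt x).1) atTop (𝓝 (torusPt x).1) :=
  ((continuous_fst.tendsto _).comp (tendsto_radius_smul x)).comp hns.tendsto_atTop

lemma starProjection_H22_boundaryTwo {f : ℂ × ℂ → ℂ} (hf : IsHInf f) :
    H22.starProjection (boundaryTwo f) = boundaryTwo (sliceZero f) := by
  classical
  refine (Submodule.eq_starProjection_of_mem_orthogonal (u := boundaryTwo f)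
    (boundaryTwo_sliceZero_mem_H22 hf) ?_)
  convert! mulOp_coord1_mem_orthogonal_H22 (boundaryTwo_mem_H2 hf.backwardShift1) using 1
  obtain ⟨ns, hns, h⟩ := exists_seq_tendsto_boundaryInf {f, sliceZero f, backwardShift1 f} (by
    simp only [Finset.mem_insert, Finset.mem_singleton]
    rintro _ (rfl | rfl | rfl)
    exacts [hf, hf.sliceZero, hf.backwardShift1])
  refine Lp.ext ?_
  filter_upwards [h, Lp.coeFn_sub (boundaryTwo f) (boundaryTwo (sliceZero f)), coeFn_boundaryTwo f,
    coeFn_boundaryTwo (sliceZero f), coeFn_boundaryTwo (backwardShift1 f), coeFn_coord1,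
    coeFn_mulOp coord1 (boundaryTwo (backwardShift1 f))] with x hx h1 h2 h3 h4 h5 h6
  simp only [Finset.mem_insert, Finset.mem_singleton, forall_eq_or_imp, forall_eq] at hx
  rw [h1, h6, Pi.sub_apply, h2, h3, h4, h5, mFourier_one_zero]
  refine tendsto_nhds_unique (hx.1.sub hx.2.1)
    (((tendsto_radius_smul_fst hns x).mul hx.2.2).congr fun i => ?_)
  exact backwardShift1_add_mul f _

/-! ### The function `ψ¹_α` and the space `φ H²` -/

lemma one_sub_ne_zero_of_isInner {φ : ℂ × ℂ → ℂ} (hφ : IsInner φ) {α : ℂ} (hα : ‖α‖ = 1)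
    (hne : ∃ z ∈ bidisk, ∃ w ∈ bidisk, φ z ≠ φ w) {z : ℂ × ℂ} (hz : z ∈ bidisk) :
    1 - conj α * φ z ≠ 0 := fun h => by
  have h1 : ‖conj α * φ z‖ = 1 := by rw [← sub_eq_zero.1 h, norm_one]
  rw [norm_mul, RCLike.norm_conj, hα, one_mul] at h1
  exact (hφ.norm_lt_one hne hz).ne h1

lemma isHInf_psi1 {φ : ℂ × ℂ → ℂ} (hφ : IsInner φ) {α : ℂ} (hα : ‖α‖ = 1)
    (hne : ∃ z ∈ bidisk, ∃ w ∈ bidisk, φ z ≠ φ w) (hψ : BoundedOnBidisk (psi1 φ α)) :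
    IsHInf (psi1 φ α) := by
  have hB := hφ.isHInf.backwardShift1.holo
  have h0 : (0 : ℂ) ∈ Metric.ball (0 : ℂ) 1 := Metric.mem_ball_self one_pos
  have hden : ∀ w ∈ Metric.ball (0 : ℂ) 1, 1 - conj α * φ (0, w) ≠ 0 := fun w hw =>
    one_sub_ne_zero_of_isInner hφ hα hne (mk_mem_bidisk h0 hw)
  refine ⟨⟨fun w hw => ?_, fun z hz => ?_⟩, hψ⟩
  · have h := hB.left w hw
    simp only [psi1]
    fun_prop
  · have h := (hB.right z hz).fun_div
      (((hφ.isHInf.holo.right 0 h0).const_mul (conj α)).const_sub 1) hden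
    exact h.const_mul (conj α)

/-- The boundary form of `z₁ ψ¹_α (1 - ᾱ φ(0, z₂)) = ᾱ (φ - φ(0, z₂))`. -/
lemma boundaryInf_psi1 {φ : ℂ × ℂ → ℂ} (hφ : IsInner φ) {α : ℂ} (hα : ‖α‖ = 1)
    (hne : ∃ z ∈ bidisk, ∃ w ∈ bidisk, φ z ≠ φ w) (hψ : BoundedOnBidisk (psi1 φ α)) :
    ∀ᵐ x ∂torusMeasure, (torusPt x).1 * boundaryInf (psi1 φ α) x *
      (1 - conj α * boundaryInf (sliceZero φ) x) =
        conj α * (boundaryInf φ x - boundaryInf (sliceZero φ) x) := by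
  classical
  obtain ⟨ns, hns, h⟩ := exists_seq_tendsto_boundaryInf {psi1 φ α, φ, sliceZero φ} (by
    simp only [Finset.mem_insert, Finset.mem_singleton]
    rintro _ (rfl | rfl | rfl)
    exacts [isHInf_psi1 hφ hα hne hψ, hφ.isHInf, hφ.isHInf.sliceZero])
  filter_upwards [h] with x hx
  simp only [Finset.mem_insert, Finset.mem_singleton, forall_eq_or_imp, forall_eq] at hx
  refine tendsto_nhds_unique
    (((tendsto_radius_smul_fst hns x).mul hx.1).mul ((hx.2.2.const_mul (conj α)).const_sub 1))
    (((hx.2.1.sub hx.2.2).const_mul (conj α)).congr fun i => ?_)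
  have hz := smul_torusPt_mem_bidisk (radius_nonneg (ns i)) (radius_lt_one (ns i)) x
  have hd := one_sub_ne_zero_of_isInner hφ hα hne (zero_mk_mem_bidisk hz)
  rw [sliceZero, ← backwardShift1_add_mul, psi1]
  field_simp

/-- The subspace `φ H²` of `L²(𝕋²)`. -/
def innerRange (φ : ℂ × ℂ → ℂ) : Submodule ℂ L2T :=
  H2.map (mulOp (boundaryInf φ) : L2T →ₗ[ℂ] L2T)

lemma completeSpace_innerRange {φ : ℂ × ℂ → ℂ} (hφ : IsInner φ) :
    CompleteSpace (innerRange φ) := by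
  let M : L2T →ₗᵢ[ℂ] L2T :=
    ⟨(mulOp (boundaryInf φ) : L2T →ₗ[ℂ] L2T), norm_mulOp_eq hφ.norm_boundaryInf⟩
  exact M.completeSpace_map H2

lemma innerRange_le_H2 {φ : ℂ × ℂ → ℂ} (hφ : IsInner φ) : innerRange φ ≤ H2 := by
  rintro _ ⟨h, hh, rfl⟩
  exact mulOp_mem_H2 hφ.isHInf hh

/-- Since `φ H²` is closed in `H²`, it is the orthogonal complement of `K_φ` in `H²`. -/
lemma mem_innerRange_of_orthogonal {φ : ℂ × ℂ → ℂ} (hφ : IsInner φ) {x : L2T} (hx : x ∈ H2)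
    (h : ∀ f ∈ modelSpace φ, inner ℂ f x = 0) : x ∈ innerRange φ := by
  have := completeSpace_innerRange hφ
  set p := (innerRange φ).starProjection x with hp
  have hpm : p ∈ innerRange φ := (innerRange φ).starProjection_apply_mem x
  have hort : x - p ∈ (innerRange φ)ᗮ := (innerRange φ).sub_starProjection_mem_orthogonal x
  have hK : x - p ∈ modelSpace φ := ⟨H2.sub_mem hx (innerRange_le_H2 hφ hpm), hort⟩
  have h0 : inner ℂ (x - p) (x - p) = 0 := by
    rw [inner_sub_right, h _ hK, Submodule.inner_left_of_mem_orthogonal hpm hort, sub_zero]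
  rw [sub_eq_zero.1 (inner_self_eq_zero.1 h0)]
  exact hpm

/-- `P_{H²₂} M_{ψ̄}` is the adjoint of `M_ψ P_{H²₂}`, and `P_{H²₂} φ = φ(0, z₂)`. -/
lemma inner_perturbation1 {φ : ℂ × ℂ → ℂ} (hφ : IsInner φ) (α : ℂ) (f : modelSpace φ) :
    inner ℂ (perturbation1 φ α f) (boundaryTwo φ) =
      inner ℂ (f : L2T) (mulOp (boundaryInf (psi1 φ α)) (boundaryTwo (sliceZero φ))) := by
  rw [← starProjection_H22_boundaryTwo hφ.isHInf, ← inner_mulOp_star]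
  exact H22.inner_starProjection_left_eq_right _ _

lemma boundaryTwo_mem_innerRange (φ : ℂ × ℂ → ℂ) : boundaryTwo φ ∈ innerRange φ :=
  ⟨monomial 0, monomial_zero_mem_H2, rfl⟩

/-- If `ψ¹_α φ(0, z₂) = φ h` with `h ∈ H²`, then `φ u = φ(0, z₂)²` for
`u = φ(0, z₂) - α z₁ (1 - ᾱ φ(0, z₂)) h`. Here `‖u‖ = ‖φ(0, z₂)²‖ ≤ ‖φ(0, z₂)‖`, whereas the two
terms of `u` are orthogonal, so the second one vanishes. -/
lemma boundaryInf_mul_sliceZero_of_mem_innerRange {φ : ℂ × ℂ → ℂ} (hφ : IsInner φ) {α : ℂ}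
    (hα : ‖α‖ = 1) (hne : ∃ z ∈ bidisk, ∃ w ∈ bidisk, φ z ≠ φ w)
    (hψ : BoundedOnBidisk (psi1 φ α))
    (hmem : mulOp (boundaryInf (psi1 φ α)) (boundaryTwo (sliceZero φ)) ∈ innerRange φ) :
    ∀ᵐ x ∂torusMeasure, boundaryInf φ x * boundaryInf (sliceZero φ) x =
      boundaryInf (sliceZero φ) x * boundaryInf (sliceZero φ) x := by
  obtain ⟨h, hh, hx⟩ := hmem
  change mulOp (boundaryInf φ) h = _ at hx
  set Φ := boundaryInf φ
  set Φ₀ := boundaryInf (sliceZero φ) with hΦ₀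
  set Ψ := boundaryInf (psi1 φ α)
  set F₀ := boundaryTwo (sliceZero φ)
  set g : L2T := α • (h - conj α • mulOp Φ₀ h) with hg
  have hgH : g ∈ H2 :=
    H2.smul_mem _ (H2.sub_mem hh (H2.smul_mem _ (mulOp_mem_H2 hφ.isHInf.sliceZero hh)))
  set v : L2T := mulOp coord1 g with hv
  have hαα : α * conj α = 1 := by rw [Complex.mul_conj, Complex.normSq_eq_norm_sq, hα]; simp
  have hgx : ∀ᵐ x ∂torusMeasure, g x = α * (h x - conj α * (Φ₀ x * h x)) := by
    filter_upwards [Lp.coeFn_smul α (h - conj α • mulOp Φ₀ h), Lp.coeFn_sub h (conj α • mulOp Φ₀ h),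
      Lp.coeFn_smul (conj α) (mulOp Φ₀ h), coeFn_mulOp Φ₀ h] with x h1 h2 h3 h4
    rw [hg, h1, Pi.smul_apply, h2, Pi.sub_apply, h3, Pi.smul_apply, h4, smul_eq_mul, smul_eq_mul]
  have hF₀ : F₀ =ᵐ[torusMeasure] Φ₀ := coeFn_boundaryTwo _
  have hΨ : ∀ᵐ x ∂torusMeasure, Φ x * h x = Ψ x * Φ₀ x := by
    filter_upwards [coeFn_mulOp Φ h, coeFn_mulOp Ψ F₀, hF₀] with x h1 h2 h3
    rw [← h1, hx, h2, h3]
  have hvx : ∀ᵐ x ∂torusMeasure, Φ x * v x = (Φ x - Φ₀ x) * Φ₀ x := by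
    filter_upwards [coeFn_mulOp coord1 g, coeFn_coord1, hgx, hΨ,
      boundaryInf_psi1 hφ hα hne hψ] with x h1 h2 h3 h4 h5
    rw [hv, h1, h2, h3, mFourier_one_zero]
    change _ * Ψ x * (1 - conj α * Φ₀ x) = conj α * (Φ x - Φ₀ x) at h5
    linear_combination α * (torusPt x).1 * (1 - conj α * Φ₀ x) * h4 + α * Φ₀ x * h5 +
      (Φ x - Φ₀ x) * Φ₀ x * hαα
  have hu : mulOp Φ (F₀ - v) = mulOp Φ₀ F₀ := by
    refine Lp.ext ?_
    filter_upwards [coeFn_mulOp Φ (F₀ - v), coeFn_mulOp Φ₀ F₀, Lp.coeFn_sub F₀ v, hF₀, hvx]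
      with x h1 h2 h3 h4 h5
    rw [h1, h2, h3, Pi.sub_apply, h4]
    linear_combination -h5
  have hb : ∀ᵐ x ∂torusMeasure, ‖Φ₀ x‖ ≤ 1 :=
    norm_boundaryInf_le hφ.isHInf.sliceZero fun z hz => hφ.norm_le_one (zero_mk_mem_bidisk hz)
  have hle : ‖F₀ - v‖ ≤ ‖F₀‖ := by
    rw [← norm_mulOp_eq hφ.norm_boundaryInf (F₀ - v)]
    exact (congrArg norm hu).trans_le (norm_mulOp_le hb F₀)
  have hort : inner ℂ F₀ v = 0 :=
    Submodule.inner_right_of_mem_orthogonal (boundaryTwo_sliceZero_mem_H22 hφ.isHInf)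
      (mulOp_coord1_mem_orthogonal_H22 hgH)
  have hv0 : v = 0 := by
    have hpyth := norm_sub_sq (𝕜 := ℂ) F₀ v
    rw [hort, map_zero, mul_zero, sub_zero] at hpyth
    have : ‖v‖ ^ 2 ≤ 0 := by nlinarith [norm_nonneg (F₀ - v), norm_nonneg F₀]
    exact norm_eq_zero.1 (by nlinarith [norm_nonneg v])
  filter_upwards [hvx, Lp.coeFn_zero ℂ 2 torusMeasure] with x h1 h2
  rw [hv0, h2, Pi.zero_apply, mul_zero] at h1
  linear_combination -h1

lemma eq_sliceZero_of_mul {φ : ℂ × ℂ → ℂ} (hφ : IsHInf φ) (hφ0 : ∃ w : ℂ, ‖w‖ < 1 ∧ φ (0, w) ≠ 0)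
    (h : ∀ z ∈ bidisk, φ z * sliceZero φ z = sliceZero φ z * sliceZero φ z) {z : ℂ × ℂ}
    (hz : z ∈ bidisk) : φ z = φ (0, z.2) := by
  have hz1 : z.1 ∈ Metric.ball (0 : ℂ) 1 := mem_ball_zero_iff.2 hz.1
  have hz2 : z.2 ∈ Metric.ball (0 : ℂ) 1 := mem_ball_zero_iff.2 hz.2
  have hd0 := hφ.holo.right 0 (Metric.mem_ball_self one_pos)
  -- For fixed `z₁` the factors `φ(z₁, ·) - φ(0, ·)` and `φ(0, ·)` have product zero on the disk.
  rcases AnalyticOnNhd.eq_zero_or_eq_zero_of_mul_eq_zero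
    (((hφ.holo.right z.1 hz1).sub hd0).analyticOnNhd Metric.isOpen_ball)
    (hd0.analyticOnNhd Metric.isOpen_ball)
    (fun w hw => by
      have := h _ (mk_mem_bidisk hz1 hw)
      simp only [sliceZero] at this
      simp only [Pi.sub_apply]
      linear_combination this)
    (convex_ball (0 : ℂ) 1).isPreconnected with h0 | h0
  · exact sub_eq_zero.1 (h0 z.2 hz2)
  · obtain ⟨w, hw, hw0⟩ := hφ0
    exact absurd (h0 w (mem_ball_zero_iff.2 hw)) hw0

lemma exists_perturbation1_notMem {φ : ℂ × ℂ → ℂ} (hφ : IsInner φ) {α : ℂ} (hα : ‖α‖ = 1)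
    (hψ : BoundedOnBidisk (psi1 φ α)) (hφ0 : ∃ w : ℂ, ‖w‖ < 1 ∧ φ (0, w) ≠ 0)
    (hdep : ∃ z ∈ bidisk, ∃ w ∈ bidisk, z.2 = w.2 ∧ φ z ≠ φ w) :
    ∃ f : modelSpace φ, perturbation1 φ α f ∉ modelSpace φ := by
  obtain ⟨z, hz, w, hw, hzw, hne⟩ := hdep
  have hne' : ∃ z ∈ bidisk, ∃ w ∈ bidisk, φ z ≠ φ w := ⟨z, hz, w, hw, hne⟩
  by_contra! hall
  have hmem := mem_innerRange_of_orthogonal hφ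
    (mulOp_mem_H2 (isHInf_psi1 hφ hα hne' hψ) (boundaryTwo_mem_H2 hφ.isHInf.sliceZero))
    fun f hf => by
      rw [← inner_perturbation1 hφ α ⟨f, hf⟩]
      exact Submodule.inner_left_of_mem_orthogonal (boundaryTwo_mem_innerRange φ) (hall ⟨f, hf⟩).2
  have hmul := boundaryInf_mul_sliceZero_of_mem_innerRange hφ hα hne' hψ hmem
  have hs := hφ.isHInf.sliceZero
  have heq := eqOn_bidisk_of_boundaryInf (hφ.isHInf.mul hs) (hs.mul hs) (by
    filter_upwards [hmul, boundaryInf_mul hφ.isHInf hs, boundaryInf_mul hs hs] with x h1 h2 h3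
    rw [h2, h3, h1])
  refine hne ?_
  rw [eq_sliceZero_of_mul hφ.isHInf hφ0 heq hz, eq_sliceZero_of_mul hφ.isHInf hφ0 heq hw, hzw]

end BidiskClark

end

theorem mainTheorem8
    (φ : ℂ × ℂ → ℂ) (hφ : BidiskClark.IsInner φ)
    (α : ℂ) (hα : ‖α‖ = 1)
    (σ : MeasureTheory.Measure BidiskClark.Torus) (hσ : BidiskClark.IsClarkMeasure φ α σ)
    (J : BidiskClark.modelSpace φ →L[ℂ] MeasureTheory.Lp ℂ 2 σ)
    (hJ : BidiskClark.IsClarkEmbedding φ α σ J) (hJsurj : Function.Surjective J)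
    (hψ : BidiskClark.BoundedOnBidisk (BidiskClark.psi1 φ α))
    (hH22 : ∃ F ∈ BidiskClark.H22,
      BidiskClark.IsBoundaryFunction (fun z => 1 / (1 - starRingEnd ℂ α * φ (0, z.2))) F)
    (hφ0 : ∃ z₂ : ℂ, ‖z₂‖ < 1 ∧ φ (0, z₂) ≠ 0)
    (hdep₁ : ∃ z ∈ BidiskClark.bidisk, ∃ w ∈ BidiskClark.bidisk, z.2 = w.2 ∧ φ z ≠ φ w)
    (hdep₂ : ∃ z ∈ BidiskClark.bidisk, ∃ w ∈ BidiskClark.bidisk, z.1 = w.1 ∧ φ z ≠ φ w) :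
    (∃ f : BidiskClark.modelSpace φ,
      BidiskClark.perturbation1 φ α f ∉ BidiskClark.modelSpace φ) ∧
    ¬ ∀ f : BidiskClark.modelSpace φ,
      (BidiskClark.clarkUnitary1 φ α f : BidiskClark.L2T) =
        (BidiskClark.compressedShift1 φ f : BidiskClark.L2T) +
          BidiskClark.perturbation1 φ α f := by
  obtain ⟨f, hf⟩ := BidiskClark.exists_perturbation1_notMem hφ hα hψ hφ0 hdep₁
  refine ⟨⟨f, hf⟩, fun hall => hf ?_⟩
  rw [← add_left_cancel (hall f)]
  exact Subtype.coe_prop _
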